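/- Let $\mathbf k$ be a field, let $m\ge 2$, and let $I_m\subseteq \mathbf k[x_{11},x_{12},\dots,x_{m1},x_{m2}]$ be the ideal $$I_m=\langle x_{i1}^3x_{i2},\; x_{i1}^2x_{(i+1)1}x_{(i+1)2}\ :\ 1\le i\le m\rangle ,$$ where the first index is read cyclically ($m+1$ means $1$). Let $\beta_i(I_m)$ denote the (total) Betti numbers of $I_m$, that is, the rank of the $i$-th free module in a minimal graded free resolution $\cdots\to F_1\to F_0\to I_m\to 0$. Then $$\beta_0(I_m)=2m,\qquad \beta_i(I_m)=2K^m_{m-3,\,i-1}+K^m_{m-2,\,i}\quad (i\ge 1),$$ where the numbers $K^m_{a,b}$ are defined by the recurrence $$K^m_{a,b}=K^m_{a-2,\,b-1}+K^m_{a-1,\,b}\qquad(a\ge 2,\ b\ge 1)$$ with base cases $$K^m_{a,0}=m+a\ (a\ge 0),\qquad K^m_{0,b}=\binom m{b+1},\qquad K^m_{1,b}=\binom mb+\binom m{b+1}\qquad(b\ge 0),$$ together with $K^m_{-1,b}=\binom m{b+1}$ for $b\ge 0$ (needed only for $m=2$; it is the value for which the recurrence also holds at $a=1$). -/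

import Mathlib

/-- The graded maximal ideal `𝔪 = ⟨x_s : s ∈ σ⟩` of the polynomial ring `𝐤[x_s : s ∈ σ]`. -/
noncomputable def irrelevantIdeal (σ : Type*) (k : Type*) [Field k] : Ideal (MvPolynomial σ k) :=
  Ideal.span (Set.range MvPolynomial.X)

/-- A minimal graded free resolution
`⋯ → R^(rank 2) → R^(rank 1) → R^(rank 0) → I → 0`
of an ideal `I` of `R = 𝐤[x_s : s ∈ σ]`, with finitely generated free modules.
The `j`-th basis vector of the `i`-th module has degree `shift i j`. -/
structure MinimalGradedFreeResolution {σ : Type*} {k : Type*} [Field k]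
    (I : Ideal (MvPolynomial σ k)) where
  /-- the rank of the `i`-th free module -/
  rank : ℕ → ℕ
  /-- the degrees of the basis vectors of the `i`-th free module -/
  shift : (i : ℕ) → Fin (rank i) → ℕ
  /-- the differential from the `(i + 1)`-st to the `i`-th free module -/
  d : (i : ℕ) →
    (Fin (rank (i + 1)) → MvPolynomial σ k) →ₗ[MvPolynomial σ k] (Fin (rank i) → MvPolynomial σ k)
  /-- the augmentation, a map onto `I ⊆ R` -/
  aug : (Fin (rank 0) → MvPolynomial σ k) →ₗ[MvPolynomial σ k] MvPolynomial σ k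
  range_aug : LinearMap.range aug = I
  exact_zero : Function.Exact (d 0) aug
  exact_succ : ∀ i, Function.Exact (d (i + 1)) (d i)
  /-- the augmentation is homogeneous of degree `0` -/
  aug_homogeneous : ∀ j, (aug (Pi.single j 1)).IsHomogeneous (shift 0 j)
  /-- the differentials are homogeneous of degree `0`: each matrix entry is zero, or homogeneous
  of degree the difference of the degrees of the two basis vectors concerned -/
  d_homogeneous : ∀ i j l, d i (Pi.single j 1) l = 0 ∨
    ∃ e : ℕ, shift (i + 1) j = shift i l + e ∧ (d i (Pi.single j 1) l).IsHomogeneous e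
  /-- minimality: the image of each differential lies in `𝔪 F`, i.e. it has all its coordinates
  in `𝔪` -/
  minimal : ∀ i v l, d i v l ∈ irrelevantIdeal σ k

/-- `β` is the sequence of (total) Betti numbers of the ideal `I`: the ideal `I` has a minimal graded
free resolution, and in every such resolution the `i`-th free module has rank `β i`. -/
def IsBettiSequence {σ : Type*} {k : Type*} [Field k]
    (I : Ideal (MvPolynomial σ k)) (β : ℕ → ℕ) : Prop :=
  Nonempty (MinimalGradedFreeResolution I) ∧
    ∀ (F : MinimalGradedFreeResolution I) (i : ℕ), F.rank i = β i

/-- The ideal `I_m` of `𝐤[x_{i1}, x_{i2} : i cyclic mod m]` generated by the monomials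
`x_{i1}^3 x_{i2}` and `x_{i1}^2 x_{(i+1)1} x_{(i+1)2}`. The variables `x_{i1}`, `x_{i2}` are
`X (i, 0)`, `X (i, 1)`; `finRotate m` is the cyclic successor on `Fin m`. -/
noncomputable def diamondIdeal (k : Type*) [Field k] (m : ℕ) :
    Ideal (MvPolynomial (Fin m × Fin 2) k) :=
  Ideal.span
    (Set.range (fun i : Fin m =>
        (MvPolynomial.X (i, 0) ^ 3 * MvPolynomial.X (i, 1) : MvPolynomial (Fin m × Fin 2) k)) ∪
      Set.range (fun i : Fin m =>
        (MvPolynomial.X (i, 0) ^ 2 * MvPolynomial.X (finRotate m i, 0) *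
          MvPolynomial.X (finRotate m i, 1) : MvPolynomial (Fin m × Fin 2) k)))

/-- The numbers `K^m_{a,b}` for `a ≥ 0`. -/
def diamondKNat (m : ℕ) : ℕ → ℕ → ℕ
  | a, 0 => m + a
  | 0, i + 1 => m.choose (i + 2)
  | 1, i + 1 => m.choose (i + 1) + m.choose (i + 2)
  | a + 2, b + 1 => diamondKNat m a b + diamondKNat m (a + 1) (b + 1)

/-- The numbers `K^m_{a,b}` for an integer `a ≥ -1` (only `a = -1` of the negative values is used,
and only for `m = 2`): the value `K^m_{-1,b} = (m choose b+1)` is the one that the recurrence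
forces at `a = 1`, see `diamondK_rec`. -/
def diamondK (m : ℕ) : ℤ → ℕ → ℕ
  | Int.ofNat a, b => diamondKNat m a b
  | Int.negSucc _, b => m.choose (b + 1)

theorem diamondK_base_right (m a : ℕ) : diamondK m a 0 = m + a := by
  change diamondKNat m a 0 = m + a
  rw [diamondKNat]

theorem diamondK_base_zero (m i : ℕ) : diamondK m 0 i = m.choose (i + 1) := by
  change diamondKNat m 0 i = _
  cases i <;> simp [diamondKNat]

theorem diamondK_base_one (m i : ℕ) : diamondK m 1 i = m.choose i + m.choose (i + 1) := by
  change diamondKNat m 1 i = _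
  cases i with
  | zero => simp [diamondKNat, Nat.add_comm]
  | succ i => simp [diamondKNat]

theorem diamondK_rec (m : ℕ) (a : ℤ) (ha : 1 ≤ a) (b : ℕ) :
    diamondK m a (b + 1) = diamondK m (a - 2) b + diamondK m (a - 1) (b + 1) := by
  obtain ⟨n, rfl⟩ : ∃ n : ℕ, a = n + 1 := ⟨(a - 1).toNat, by omega⟩
  cases n with
  | zero =>
    change diamondKNat m 1 (b + 1) = m.choose (b + 1) + diamondKNat m 0 (b + 1)
    simp [diamondKNat]
  | succ n =>
    have h1 : ((n + 1 : ℕ) : ℤ) + 1 - 2 = Int.ofNat n := by simp; omega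
    have h2 : ((n + 1 : ℕ) : ℤ) + 1 - 1 = Int.ofNat (n + 1) := by simp
    have h3 : ((n + 1 : ℕ) : ℤ) + 1 = Int.ofNat (n + 2) := by simp; omega
    rw [h1, h2, h3]
    change diamondKNat m (n + 2) (b + 1) = diamondKNat m n b + diamondKNat m (n + 1) (b + 1)
    rw [diamondKNat]

/-! Let the `2m` generators label the vertices of the simplicial complex `Δ` whose faces contain no
two cyclically adjacent generators of the first kind. The Taylor differential restricted to `Δ` is a
minimal resolution, so `β_i` counts the faces with `i + 1` vertices.

Exactness is checked one multidegree `α` at a time, where the complex becomes the simplicial chain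
complex of the faces whose label divides `α`. That subcomplex, if it has a vertex, is a cone
(`isConical_diamond`). Minimality holds because adding a vertex strictly enlarges the lcm
(`not_diamondExponent_le_label`). Any two minimal resolutions have equal ranks (`rank_eq_rank`).

A face is an independent set of the `m`-cycle together with an arbitrary set of generators of the
second kind. With `P_a` the independence polynomial of the path on `a` vertices, the face polynomial
is `(1 + X)^m (P_{m-2} + 2 X P_{m-3})`, and `K^m_{a,b}` is the coefficient of `X^(b+1)` in `(1 +
X)^m P_a`. -/

/-! ### Uniqueness of the ranks of a minimal resolution. -/

namespace MinimalGradedFreeResolution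

theorem exists_lift_of_forall_mem_range {R M N : Type*} [CommRing R] [AddCommGroup M] [Module R M]
    [AddCommGroup N] [Module R N] {n : ℕ} (f : (Fin n → R) →ₗ[R] N) (g : M →ₗ[R] N)
    (h : ∀ x, f x ∈ LinearMap.range g) : ∃ l : (Fin n → R) →ₗ[R] M, g ∘ₗ l = f := by
  obtain ⟨l, hl⟩ := Module.projective_lifting_property g.rangeRestrict (f.codRestrict _ h)
    g.surjective_rangeRestrict
  refine ⟨l, LinearMap.ext fun x => ?_⟩
  simpa using congrArg Subtype.val (LinearMap.congr_fun hl x)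

theorem map_coord_mem {R : Type*} [CommRing R] {a b : ℕ} (J : Ideal R)
    (f : (Fin a → R) →ₗ[R] (Fin b → R)) (x : Fin a → R) (hx : ∀ j, x j ∈ J) (l : Fin b) :
    f x l ∈ J := by
  rw [pi_eq_sum_univ' x, map_sum, Finset.sum_apply]
  refine Ideal.sum_mem _ fun j _ => ?_
  rw [map_smul, Pi.smul_apply, smul_eq_mul]
  exact J.mul_mem_right _ (hx j)

/-- Modulo `J` the composite becomes the identity, so `f` becomes injective between free modules
over the nontrivial ring `R ⧸ J`. -/
theorem card_le_of_comp_sub_id_mem {R : Type*} [CommRing R] {a b : ℕ} (J : Ideal R) (hJ : J ≠ ⊤)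
    (f : (Fin a → R) →ₗ[R] (Fin b → R)) (g : (Fin b → R) →ₗ[R] (Fin a → R))
    (h : ∀ x l, (g (f x) - x) l ∈ J) : a ≤ b := by
  have : Nontrivial (R ⧸ J) := Ideal.Quotient.nontrivial_iff.mpr hJ
  let A := (LinearMap.toMatrix' f).map (Ideal.Quotient.mk J)
  let B := (LinearMap.toMatrix' g).map (Ideal.Quotient.mk J)
  have hBA : B * A = 1 := by
    rw [← Matrix.map_mul, ← LinearMap.toMatrix'_comp]
    ext i j
    have := h (Pi.single j 1) i
    rw [Pi.sub_apply, ← Ideal.Quotient.eq] at this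
    rw [Matrix.map_apply, LinearMap.toMatrix'_apply, LinearMap.comp_apply, this, Matrix.one_apply,
      Pi.single_apply]
    split_ifs <;> simp
  have hinj : Function.Injective (Matrix.toLin' A) := by
    refine Function.LeftInverse.injective (g := Matrix.toLin' B) fun x => ?_
    rw [← LinearMap.comp_apply, ← Matrix.toLin'_mul, hBA, Matrix.toLin'_one, LinearMap.id_apply]
  exact le_of_fin_injective (R ⧸ J) _ hinj

theorem irrelevantIdeal_ne_top (σ k : Type*) [Field k] : irrelevantIdeal σ k ≠ ⊤ := by
  intro h
  have h1 : irrelevantIdeal σ k ≤ RingHom.ker (MvPolynomial.constantCoeff (R := k) (σ := σ)) := by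
    refine Ideal.span_le.mpr ?_
    rintro _ ⟨i, rfl⟩
    simp [RingHom.mem_ker]
  rw [h, top_le_iff] at h1
  exact RingHom.ker_ne_top _ h1

variable {σ k : Type*} [Field k] {I : Ideal (MvPolynomial σ k)}

/-- In homological degree `i`, comparison maps between two minimal resolutions exist whose
composition is homotopic to the identity, and hence the identity modulo `𝔪`. -/
theorem exists_comparison (F G : MinimalGradedFreeResolution I) (i : ℕ) :
    ∃ (f : (Fin (F.rank i) → MvPolynomial σ k) →ₗ[MvPolynomial σ k]
          (Fin (G.rank i) → MvPolynomial σ k))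
      (g : (Fin (G.rank i) → MvPolynomial σ k) →ₗ[MvPolynomial σ k]
          (Fin (F.rank i) → MvPolynomial σ k))
      (s : (Fin (F.rank i) → MvPolynomial σ k) →ₗ[MvPolynomial σ k]
          (Fin (F.rank (i + 1)) → MvPolynomial σ k))
      (r : (Fin (F.rank i) → MvPolynomial σ k) →ₗ[MvPolynomial σ k]
          (Fin (F.rank i) → MvPolynomial σ k)),
      (∀ x, f (F.d i x) ∈ LinearMap.range (G.d i)) ∧
      (∀ x, g (G.d i x) ∈ LinearMap.range (F.d i)) ∧
      (∀ x, g (f x) - x = F.d i (s x) + r x) ∧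
      (∀ x, r (F.d i x) = 0) ∧ ∀ x l, r x l ∈ irrelevantIdeal σ k := by
  induction i with
  | zero =>
    obtain ⟨f, hf⟩ := exists_lift_of_forall_mem_range F.aug G.aug fun x => by
      exact G.range_aug.ge (F.range_aug.le ⟨x, rfl⟩)
    obtain ⟨g, hg⟩ := exists_lift_of_forall_mem_range G.aug F.aug fun x => by
      exact F.range_aug.ge (G.range_aug.le ⟨x, rfl⟩)
    replace hf := LinearMap.congr_fun hf
    replace hg := LinearMap.congr_fun hg
    simp only [LinearMap.comp_apply] at hf hg
    obtain ⟨s, hs⟩ := exists_lift_of_forall_mem_range (g ∘ₗ f - LinearMap.id) (F.d 0) fun x => by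
      refine (F.exact_zero _).mp ?_
      simp [hf, hg]
    refine ⟨f, g, s, 0, fun x => (G.exact_zero _).mp ?_, fun x => (F.exact_zero _).mp ?_,
      fun x => ?_, fun x => rfl, fun x l => Submodule.zero_mem _⟩
    · rw [hf]; exact F.exact_zero.apply_apply_eq_zero x
    · rw [hg]; exact G.exact_zero.apply_apply_eq_zero x
    · simpa using (LinearMap.congr_fun hs x).symm
  | succ i ih =>
    obtain ⟨f, g, s, r, hf, hg, hs, hr, -⟩ := ih
    obtain ⟨f', hf'⟩ := exists_lift_of_forall_mem_range (f ∘ₗ F.d i) (G.d i) hf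
    obtain ⟨g', hg'⟩ := exists_lift_of_forall_mem_range (g ∘ₗ G.d i) (F.d i) hg
    replace hf' := LinearMap.congr_fun hf'
    replace hg' := LinearMap.congr_fun hg'
    simp only [LinearMap.comp_apply] at hf' hg'
    -- The next homotopy exists because `d g' f' = g f d = d + d s d`, the term `r d` being zero.
    obtain ⟨s', hs'⟩ := exists_lift_of_forall_mem_range (g' ∘ₗ f' - LinearMap.id - s ∘ₗ F.d i)
      (F.d (i + 1)) fun x => by
      refine (F.exact_succ i _).mp ?_
      have := hs (F.d i x)
      rw [hr, add_zero] at this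
      simp [hf', hg', this]
    -- The new error term `s ∘ d` dies on boundaries since `d ∘ d = 0`, and has coordinates in `𝔪`
    -- by minimality.
    refine ⟨f', g', s', s ∘ₗ F.d i, fun x => (G.exact_succ i _).mp ?_,
      fun x => (F.exact_succ i _).mp ?_, fun x => ?_, fun x => ?_, fun x l => ?_⟩
    · rw [hf', (F.exact_succ i).apply_apply_eq_zero x, map_zero]
    · rw [hg', (G.exact_succ i).apply_apply_eq_zero x, map_zero]
    · have := LinearMap.congr_fun hs' x
      simp only [LinearMap.comp_apply, LinearMap.sub_apply, LinearMap.id_apply] at this ⊢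
      rw [this]; abel
    · rw [LinearMap.comp_apply, (F.exact_succ i).apply_apply_eq_zero x, map_zero]
    · exact map_coord_mem _ s _ (F.minimal i x) l

theorem rank_le_rank (F G : MinimalGradedFreeResolution I) (i : ℕ) : F.rank i ≤ G.rank i := by
  obtain ⟨f, g, s, r, -, -, hs, -, hr⟩ := exists_comparison F G i
  refine card_le_of_comp_sub_id_mem _ (irrelevantIdeal_ne_top σ k) f g fun x l => ?_
  rw [hs, Pi.add_apply]
  exact Ideal.add_mem _ (F.minimal i _ l) (hr x l)

theorem rank_eq_rank (F G : MinimalGradedFreeResolution I) (i : ℕ) : F.rank i = G.rank i :=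
  le_antisymm (rank_le_rank F G i) (rank_le_rank G F i)

end MinimalGradedFreeResolution

set_option linter.unusedSectionVars false

/-! ### Simplicial chains, including the empty face, and cones. -/

namespace SimplicialResolution
open Finset

section Boundary

variable {V : Type*} [Fintype V] [DecidableEq V]

/-- The sign of the vertex `v` in the face `insert v τ`. -/
noncomputable def sign (v : V) (τ : Finset V) : ℤ :=
  (-1) ^ #{w ∈ τ | Fintype.equivFin V w < Fintype.equivFin V v}

theorem sign_mul_self (v : V) (τ : Finset V) : sign v τ * sign v τ = 1 := by
  rw [sign, ← mul_pow]; simp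

theorem sign_insert {v w : V} {τ : Finset V} (hw : w ∉ τ) :
    sign v (insert w τ) =
      (if Fintype.equivFin V w < Fintype.equivFin V v then -1 else 1) * sign v τ := by
  rw [sign, filter_insert]
  split_ifs with h
  · rw [card_insert_of_notMem (by simp [hw]), pow_succ, sign]; ring
  · rw [sign, one_mul]

theorem sign_insert_mul {v w : V} {τ : Finset V} (hv : v ∉ τ) (hw : w ∉ τ) (hvw : v ≠ w) :
    sign v τ * sign w (insert v τ) = -(sign w τ * sign v (insert w τ)) := by
  rw [sign_insert hv, sign_insert hw]
  have := (Fintype.equivFin V).injective.ne hvw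
  rcases lt_or_gt_of_ne this with h | h
  · rw [if_pos h, if_neg h.le.not_gt]; ring
  · rw [if_pos h, if_neg h.le.not_gt]; ring

variable {A : Type*} [CommRing A]

/-- The simplicial boundary, on functions on the faces. -/
noncomputable def boundary (c : Finset V → A) (τ : Finset V) : A :=
  ∑ v ∈ τᶜ, (sign v τ : A) * c (insert v τ)

theorem boundary_boundary (c : Finset V → A) : boundary (boundary c) = 0 := by
  funext τ
  simp only [boundary, mul_sum, Pi.zero_apply]
  rw [sum_sigma']
  -- Adding `v` then `w` cancels adding `w` then `v`.
  refine sum_involution (fun p _ => ⟨p.2, p.1⟩) ?_ ?_ ?_ ?_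
  · rintro ⟨v, w⟩ h
    simp only [mem_sigma, mem_compl, mem_insert, not_or] at h
    have := sign_insert_mul h.1 h.2.2 (Ne.symm h.2.1)
    simp only [← mul_assoc, ← Int.cast_mul, this, Finset.insert_comm w v]
    simp
  · rintro ⟨v, w⟩ h - h'
    simp only [mem_sigma, mem_compl, mem_insert, not_or] at h
    simp only [Sigma.mk.injEq] at h'
    exact h.2.1 h'.1
  · rintro ⟨v, w⟩ h
    simp only [mem_sigma, mem_compl, mem_insert, not_or] at h ⊢
    exact ⟨h.2.2, Ne.symm h.2.1, h.1⟩
  · rintro ⟨v, w⟩ h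
    rfl

/-- The cone with apex `u` over a chain. -/
noncomputable def cone (u : V) (c : Finset V → A) (τ : Finset V) : A :=
  if u ∈ τ then (sign u (τ.erase u) : A) * c (τ.erase u) else 0

/-- At a face without `u` only the vertex `u` contributes, giving `c` back. At `insert u ρ` the sum
is what the cycle condition at `ρ` equates with `c (insert u ρ)`. -/
theorem boundary_cone (u : V) (c : Finset V → A) (hc : boundary c = 0) :
    boundary (cone u c) = c := by
  funext τ
  by_cases hu : u ∈ τ
  · obtain ⟨ρ, hρ, rfl⟩ : ∃ ρ, u ∉ ρ ∧ τ = insert u ρ :=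
      ⟨τ.erase u, notMem_erase u τ, (insert_erase hu).symm⟩
    have h0 := congrFun hc ρ
    have hcompl : ρᶜ = insert u (insert u ρ)ᶜ := by
      ext x
      by_cases h : x = u
      · simp [h, hρ]
      · simp [h]
    simp only [boundary, Pi.zero_apply] at h0 ⊢
    rw [hcompl, sum_insert (by simp)] at h0
    have key : ∀ v ∈ (insert u ρ)ᶜ, (sign v (insert u ρ) : A) * cone u c (insert v (insert u ρ)) =
        -((sign u ρ : A) * ((sign v ρ : A) * c (insert v ρ))) := by
      intro v hv
      simp only [mem_compl, mem_insert, not_or] at hv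
      have h1 : (insert v (insert u ρ)).erase u = insert v ρ := by
        rw [Finset.insert_comm, erase_insert]
        simpa [hρ] using Ne.symm hv.1
      have h2 := sign_insert_mul hv.2 hρ hv.1
      have h3 : sign v (insert u ρ) * sign u (insert v ρ) = -(sign u ρ * sign v ρ) := by
        linear_combination (sign v ρ * sign v (insert u ρ)) * h2 -
          (sign v (insert u ρ) * sign u (insert v ρ)) * sign_mul_self v ρ -
          (sign u ρ * sign v ρ) * sign_mul_self v (insert u ρ)
      rw [cone, if_pos (by simp), h1, ← mul_assoc, ← mul_assoc, ← Int.cast_mul, h3]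
      push_cast; ring
    rw [sum_congr rfl key, sum_neg_distrib, ← mul_sum]
    have h4 : (sign u ρ : A) * sign u ρ = 1 := by rw [← Int.cast_mul, sign_mul_self, Int.cast_one]
    linear_combination -(sign u ρ : A) * h0 + c (insert u ρ) * h4
  · rw [boundary, sum_eq_single_of_mem u (by simpa using hu)]
    · rw [cone, if_pos (by simp), erase_insert hu, ← mul_assoc, ← Int.cast_mul, sign_mul_self]
      simp
    · intro v _ hv
      rw [cone, if_neg (by simp [hu, Ne.symm hv]), mul_zero]

end Boundary

/-! ### Exactness of labelled complexes, one multidegree at a time. -/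

section Differential

open MvPolynomial

variable {V s k : Type*} [Fintype V] [DecidableEq V] [Field k]

/-- The exponent of the least common multiple of the monomials that label the vertices of `σ`. -/
noncomputable def label (e : V → s →₀ ℕ) (σ : Finset V) : s →₀ ℕ := σ.sup e

theorem label_mono (e : V → s →₀ ℕ) {σ τ : Finset V} (h : σ ⊆ τ) : label e σ ≤ label e τ :=
  sup_mono h

/-- The differential of the Taylor complex of the monomials with exponents `e v`. -/
noncomputable def differential (e : V → s →₀ ℕ) :
    (Finset V → MvPolynomial s k) →ₗ[MvPolynomial s k] (Finset V → MvPolynomial s k) where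
  toFun f τ := ∑ v ∈ τᶜ,
    monomial (label e (insert v τ) - label e τ) (sign v τ : k) * f (insert v τ)
  map_add' f g := by funext τ; simp [mul_add, sum_add_distrib]
  map_smul' r f := by
    funext τ
    simp only [Pi.smul_apply, smul_eq_mul, mul_sum, RingHom.id_apply]
    exact sum_congr rfl fun _ _ => by ring

theorem differential_apply (e : V → s →₀ ℕ) (f : Finset V → MvPolynomial s k) (τ : Finset V) :
    differential e f τ = ∑ v ∈ τᶜ,
      monomial (label e (insert v τ) - label e τ) (sign v τ : k) * f (insert v τ) := rfl

open Classical in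
/-- The component of multidegree `α`, as a simplicial chain. -/
noncomputable def strand (e : V → s →₀ ℕ) (α : s →₀ ℕ) (f : Finset V → MvPolynomial s k)
    (σ : Finset V) : k :=
  if label e σ ≤ α then (f σ).coeff (α - label e σ) else 0

/-- The monomial factors only correct multidegrees, so in degree `α` only the signs survive. This
reduces exactness to simplicial acyclicity. -/
theorem strand_differential (e : V → s →₀ ℕ) (α : s →₀ ℕ) (f : Finset V → MvPolynomial s k) :
    strand e α (differential e f) = boundary (strand e α f) := by
  classical
  funext τ
  simp only [strand, boundary, differential_apply, coeff_sum, coeff_monomial_mul']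
  split_ifs with h
  · refine sum_congr rfl fun v _ => ?_
    have h1 := label_mono e (subset_insert v τ)
    by_cases h2 : label e (insert v τ) ≤ α
    · rw [if_pos h2, if_pos (tsub_le_tsub_right h2 _), tsub_tsub_tsub_cancel_right h1]
    · rw [if_neg h2, if_neg, mul_zero]
      rwa [tsub_le_tsub_iff_right h]
  · refine (sum_eq_zero fun v _ => ?_).symm
    rw [if_neg fun h' => h ((label_mono e (subset_insert v τ)).trans h'), mul_zero]

theorem eq_of_strand_eq (e : V → s →₀ ℕ) {f g : Finset V → MvPolynomial s k}
    (h : ∀ α, strand e α f = strand e α g) : f = g := by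
  funext σ
  ext γ
  have := congrFun (h (γ + label e σ)) σ
  simpa [strand] using this

theorem differential_differential (e : V → s →₀ ℕ) (f : Finset V → MvPolynomial s k) :
    differential e (differential e f) = 0 := by
  refine eq_of_strand_eq e fun α => ?_
  rw [strand_differential, strand_differential, boundary_boundary]
  funext σ
  simp [strand]

/-- Chains of prescribed support that are compatible with the labels and almost all zero are the
strands of a single element. -/
theorem exists_strand_eq (e : V → s →₀ ℕ) (c : (s →₀ ℕ) → Finset V → k) (D : Finset (s →₀ ℕ))
    (hD : ∀ α ∉ D, c α = 0) (hc : ∀ α σ, c α σ ≠ 0 → label e σ ≤ α) :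
    ∃ g : Finset V → MvPolynomial s k, ∀ α, strand e α g = c α := by
  classical
  -- Multiplying the value at `σ` by the monomial of exponent `β - label e σ` places the chain `c β`
  -- in multidegree `β`.
  refine ⟨fun σ => ∑ β ∈ D, if label e σ ≤ β then monomial (β - label e σ) (c β σ) else 0,
    fun α => ?_⟩
  funext σ
  rw [strand]
  split_ifs with h
  · rw [coeff_sum]
    have : ∀ β ∈ D, coeff (α - label e σ)
        (if label e σ ≤ β then monomial (β - label e σ) (c β σ) else 0) =
        if β = α then c α σ else 0 := by
      intro β _
      by_cases hβ : label e σ ≤ β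
      · rw [if_pos hβ, coeff_monomial]
        simp only [tsub_left_inj hβ h]
        split_ifs with h'
        · rw [h']
        · rfl
      · rw [if_neg hβ, if_neg (by rintro rfl; exact hβ h), coeff_zero]
    rw [sum_congr rfl this, sum_ite_eq']
    split_ifs with hα
    · rfl
    · rw [hD α hα]; rfl
  · by_contra h'
    exact h (hc α σ (Ne.symm h'))

theorem exists_finset_strand_eq_zero (e : V → s →₀ ℕ) (f : Finset V → MvPolynomial s k) :
    ∃ D : Finset (s →₀ ℕ), ∀ α ∉ D, strand e α f = 0 := by
  classical
  refine ⟨univ.biUnion fun σ => (f σ).support.image (· + label e σ), fun α hα => ?_⟩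
  funext σ
  rw [strand, Pi.zero_apply]
  split_ifs with h
  · by_contra h'
    refine hα (mem_biUnion.mpr ⟨σ, mem_univ _, mem_image.mpr ⟨α - label e σ, ?_, ?_⟩⟩)
    · exact mem_support_iff.mpr h'
    · exact tsub_add_cancel_of_le h
  · rfl

/-- A simplicial complex with vertices labelled by monomials whose subcomplexes below a given
degree are cones or have no vertices. -/
structure IsConical (e : V → s →₀ ℕ) (Δ : Finset (Finset V)) : Prop where
  mem_of_subset : ∀ σ ∈ Δ, ∀ τ ⊆ σ, τ ∈ Δ
  exists_apex : ∀ α, ∀ v, {v} ∈ Δ → e v ≤ α →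
    ∃ u, e u ≤ α ∧ ∀ σ ∈ Δ, label e σ ≤ α → insert u σ ∈ Δ

theorem IsConical.exists_apex_of_mem {e : V → s →₀ ℕ} {Δ : Finset (Finset V)}
    (h : IsConical e Δ) {α : s →₀ ℕ} {σ : Finset V} (hσ : σ ∈ Δ) (hne : σ.Nonempty)
    (hα : label e σ ≤ α) : ∃ u, e u ≤ α ∧ ∀ σ ∈ Δ, label e σ ≤ α → insert u σ ∈ Δ := by
  obtain ⟨v, hv⟩ := hne
  exact h.exists_apex α v (h.mem_of_subset σ hσ _ (by simpa using hv)) ((le_sup hv).trans hα)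

/-- The faces with `n` vertices. -/
def faces (Δ : Finset (Finset V)) (n : ℕ) : Finset (Finset V) := {σ ∈ Δ | #σ = n}

theorem IsConical.differential_eq_zero {e : V → s →₀ ℕ} {Δ : Finset (Finset V)}
    (h : IsConical e Δ) {n : ℕ} {f : Finset V → MvPolynomial s k}
    (hf : ∀ σ ∉ faces Δ (n + 1), f σ = 0) : ∀ σ ∉ faces Δ n, differential e f σ = 0 := by
  intro τ hτ
  rw [differential_apply]
  refine sum_eq_zero fun v hv => ?_
  rw [hf, mul_zero]
  intro h'
  simp only [faces, mem_filter, mem_compl] at h' hτ hv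
  rw [card_insert_of_notMem hv] at h'
  exact hτ ⟨h.mem_of_subset _ h'.1 _ (subset_insert v τ), by omega⟩

/-- Each strand is a cycle, hence bounds its cone over the apex for that degree; the cones assemble
into one element. -/
theorem IsConical.exists_differential_eq {e : V → s →₀ ℕ} {Δ : Finset (Finset V)}
    (h : IsConical e Δ) {n : ℕ} {f : Finset V → MvPolynomial s k}
    (hf : ∀ σ ∉ faces Δ (n + 1), f σ = 0) (hd : differential e f = 0) :
    ∃ g : Finset V → MvPolynomial s k, (∀ σ ∉ faces Δ (n + 2), g σ = 0) ∧
      differential e g = f := by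
  classical
  have hs : ∀ α σ, strand e α f σ ≠ 0 → σ ∈ faces Δ (n + 1) ∧ label e σ ≤ α := by
    intro α σ h0
    rw [strand] at h0
    split_ifs at h0 with h1
    · refine ⟨by_contra fun h2 => h0 ?_, h1⟩
      rw [hf σ h2, coeff_zero]
    · exact absurd rfl h0
  have hb : ∀ α, boundary (strand e α f) = 0 := by
    intro α
    rw [← strand_differential, hd]
    funext σ
    simp [strand]
  -- Choosing zero wherever the strand is zero leaves finitely many nonzero chains, as gluing
  -- requires.
  have hex : ∀ α, ∃ c : Finset V → k, boundary c = strand e α f ∧ (strand e α f = 0 → c = 0) ∧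
      ∀ σ, c σ ≠ 0 → σ ∈ faces Δ (n + 2) ∧ label e σ ≤ α := by
    intro α
    by_cases h0 : strand e α f = 0
    · exact ⟨0, by rw [h0]; funext σ; simp [boundary], fun _ => rfl, fun σ hσ => absurd rfl hσ⟩
    obtain ⟨σ₀, hσ₀⟩ := Function.ne_iff.mp h0
    obtain ⟨h1, h2⟩ := hs α σ₀ hσ₀
    simp only [faces, mem_filter] at h1
    obtain ⟨u, hu, hcone⟩ := h.exists_apex_of_mem h1.1 (card_pos.mp (by omega)) h2
    refine ⟨cone u (strand e α f), boundary_cone u _ (hb α), fun h' => absurd h' h0,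
      fun σ hσ => ?_⟩
    rw [cone] at hσ
    split_ifs at hσ with huσ
    · obtain ⟨h3, h4⟩ := hs α _ (right_ne_zero_of_mul hσ)
      simp only [faces, mem_filter] at h3 ⊢
      have h5 := hcone _ h3.1 h4
      rw [insert_erase huσ] at h5
      rw [card_erase_of_mem huσ] at h3
      refine ⟨⟨h5, by omega⟩, ?_⟩
      rw [← insert_erase huσ, label, sup_insert]
      exact sup_le hu h4
    · exact absurd rfl hσ
  choose c hc1 hc2 hc3 using hex
  obtain ⟨D, hD⟩ := exists_finset_strand_eq_zero e f
  obtain ⟨g, hg⟩ := exists_strand_eq e c D (fun α hα => hc2 α (hD α hα))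
    fun α σ hσ => (hc3 α σ hσ).2
  refine ⟨g, fun σ hσ => ?_, eq_of_strand_eq e fun α => ?_⟩
  · ext γ
    have := congrFun (hg (γ + label e σ)) σ
    rw [strand, if_pos (by simp), add_tsub_cancel_right] at this
    rw [this, coeff_zero]
    exact by_contra fun h' => hσ (hc3 _ _ h').1
  · rw [strand_differential, hg, hc1]

end Differential

end SimplicialResolution

/-! ### The minimal free resolution supported on a conical complex. -/

namespace SimplicialResolution
open Finset MvPolynomial

section Resolution

variable {V s k : Type*} [Fintype V] [DecidableEq V] [Field k]

/-- An enumeration of the faces with `n` vertices. -/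
noncomputable def faceAt (Δ : Finset (Finset V)) (n : ℕ) (j : Fin #(faces Δ n)) : Finset V :=
  ((faces Δ n).equivFin.symm j).1

theorem faceAt_mem (Δ : Finset (Finset V)) (n : ℕ) (j : Fin #(faces Δ n)) :
    faceAt Δ n j ∈ faces Δ n := ((faces Δ n).equivFin.symm j).2

theorem faceAt_injective (Δ : Finset (Finset V)) (n : ℕ) : Function.Injective (faceAt Δ n) :=
  Subtype.val_injective.comp (faces Δ n).equivFin.symm.injective

theorem exists_faceAt_eq {Δ : Finset (Finset V)} {n : ℕ} {σ : Finset V} (h : σ ∈ faces Δ n) :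
    ∃ j, faceAt Δ n j = σ := ⟨(faces Δ n).equivFin ⟨σ, h⟩, by simp [faceAt]⟩

variable (k s) in
/-- Extension by zero of a vector indexed by the faces with `n` vertices. -/
noncomputable def extendZero (Δ : Finset (Finset V)) (n : ℕ) :
    (Fin #(faces Δ n) → MvPolynomial s k) →ₗ[MvPolynomial s k] (Finset V → MvPolynomial s k) :=
  Function.ExtendByZero.linearMap _ (faceAt Δ n)

variable (k s) in
/-- Restriction to the faces with `n` vertices. -/
noncomputable def restrictFaces (Δ : Finset (Finset V)) (n : ℕ) :
    (Finset V → MvPolynomial s k) →ₗ[MvPolynomial s k] (Fin #(faces Δ n) → MvPolynomial s k) :=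
  LinearMap.funLeft _ _ (faceAt Δ n)

theorem restrictFaces_apply (Δ : Finset (Finset V)) (n : ℕ) (f : Finset V → MvPolynomial s k)
    (j : Fin #(faces Δ n)) : restrictFaces s k Δ n f j = f (faceAt Δ n j) := rfl

theorem extendZero_apply_faceAt (Δ : Finset (Finset V)) (n : ℕ)
    (f : Fin #(faces Δ n) → MvPolynomial s k) (j : Fin #(faces Δ n)) :
    extendZero s k Δ n f (faceAt Δ n j) = f j :=
  (faceAt_injective Δ n).extend_apply f (0 : Finset V → MvPolynomial s k) j

theorem extendZero_of_notMem (Δ : Finset (Finset V)) (n : ℕ)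
    (f : Fin #(faces Δ n) → MvPolynomial s k) (σ : Finset V) (h : σ ∉ faces Δ n) :
    extendZero s k Δ n f σ = 0 :=
  Function.extend_apply' f (0 : Finset V → MvPolynomial s k) σ
    fun ⟨j, hj⟩ => h (hj ▸ faceAt_mem Δ n j)

theorem extendZero_restrictFaces {Δ : Finset (Finset V)} {n : ℕ} {f : Finset V → MvPolynomial s k}
    (h : ∀ σ ∉ faces Δ n, f σ = 0) : extendZero s k Δ n (restrictFaces s k Δ n f) = f := by
  funext σ
  by_cases hσ : σ ∈ faces Δ n
  · obtain ⟨j, rfl⟩ := exists_faceAt_eq hσ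
    rw [extendZero_apply_faceAt, restrictFaces_apply]
  · rw [extendZero_of_notMem _ _ _ _ hσ, h σ hσ]

theorem extendZero_injective (Δ : Finset (Finset V)) (n : ℕ) :
    Function.Injective (extendZero s k Δ n) := by
  intro f g h
  funext j
  rw [← extendZero_apply_faceAt Δ n f, h, extendZero_apply_faceAt]

theorem extendZero_single (Δ : Finset (Finset V)) (n : ℕ) (j : Fin #(faces Δ n)) :
    extendZero s k Δ n (Pi.single j 1) = Pi.single (faceAt Δ n j) 1 := by
  funext σ
  by_cases hσ : σ ∈ faces Δ n
  · obtain ⟨l, rfl⟩ := exists_faceAt_eq hσ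
    rw [extendZero_apply_faceAt, Pi.single_apply, Pi.single_apply]
    simp only [(faceAt_injective Δ n).eq_iff]
  · rw [extendZero_of_notMem _ _ _ _ hσ, Pi.single_apply,
      if_neg]
    rintro rfl
    exact hσ (faceAt_mem Δ n j)

theorem differential_single (e : V → s →₀ ℕ) (σ τ : Finset V) :
    differential e (Pi.single σ (1 : MvPolynomial s k)) τ = 0 ∨
      ∃ v ∉ τ, σ = insert v τ ∧ differential e (Pi.single σ (1 : MvPolynomial s k)) τ =
        monomial (label e σ - label e τ) (sign v τ : k) := by
  by_cases h : ∃ v ∉ τ, σ = insert v τ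
  · obtain ⟨v, hv, rfl⟩ := h
    refine .inr ⟨v, hv, rfl, ?_⟩
    rw [differential_apply, sum_eq_single_of_mem v (by simpa using hv)]
    · rw [Pi.single_eq_same, mul_one]
    · intro w hw hwv
      rw [Pi.single_apply, if_neg, mul_zero]
      intro h'
      rw [mem_compl] at hw
      have := h' ▸ mem_insert_self w τ
      rw [mem_insert] at this
      exact this.elim hwv hw
  · refine .inl ?_
    rw [differential_apply]
    refine sum_eq_zero fun v hv => ?_
    rw [Pi.single_apply, if_neg fun h' => h ⟨v, by simpa using hv, h'.symm⟩, mul_zero]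

theorem monomial_mem_irrelevantIdeal {a : s →₀ ℕ} (ha : a ≠ 0) (c : k) :
    monomial a c ∈ irrelevantIdeal s k := by
  obtain ⟨x, hx⟩ := Finsupp.ne_iff.mp ha
  have : monomial a c = monomial (a - Finsupp.single x 1) c * (X x : MvPolynomial s k) := by
    rw [X, monomial_mul, mul_one, tsub_add_cancel_of_le]
    rw [Finsupp.single_le_iff]
    exact Nat.one_le_iff_ne_zero.mpr hx
  rw [this]
  exact Ideal.mul_mem_left _ _ (Ideal.subset_span ⟨x, rfl⟩)

theorem label_empty (e : V → s →₀ ℕ) : label e ∅ = 0 := sup_empty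

theorem degree_label_insert (e : V → s →₀ ℕ) (v : V) (τ : Finset V) :
    (label e (insert v τ)).degree =
      (label e τ).degree + (label e (insert v τ) - label e τ).degree := by
  rw [← map_add, add_tsub_cancel_of_le (label_mono e (subset_insert v τ))]

theorem IsConical.extendZero_restrictFaces_differential {e : V → s →₀ ℕ} {Δ : Finset (Finset V)}
    (h : IsConical e Δ) (n : ℕ) (y : Fin #(faces Δ (n + 1)) → MvPolynomial s k) :
    extendZero s k Δ n (restrictFaces s k Δ n (differential e (extendZero s k Δ (n + 1) y))) =
      differential e (extendZero s k Δ (n + 1) y) :=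
  extendZero_restrictFaces (h.differential_eq_zero (extendZero_of_notMem Δ (n + 1) y))

theorem IsConical.differential_eq_zero_iff {e : V → s →₀ ℕ} {Δ : Finset (Finset V)}
    (h : IsConical e Δ) (n : ℕ) (y : Fin #(faces Δ (n + 1)) → MvPolynomial s k) :
    differential e (extendZero s k Δ (n + 1) y) = 0 ↔
      ∃ z, restrictFaces s k Δ (n + 1) (differential e (extendZero s k Δ (n + 2) z)) = y := by
  constructor
  · intro hy
    obtain ⟨g, hg, hgy⟩ := h.exists_differential_eq (extendZero_of_notMem Δ (n + 1) y) hy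
    refine ⟨restrictFaces s k Δ (n + 2) g, extendZero_injective Δ (n + 1) ?_⟩
    rw [h.extendZero_restrictFaces_differential, extendZero_restrictFaces hg, hgy]
  · rintro ⟨z, rfl⟩
    rw [h.extendZero_restrictFaces_differential, differential_differential]

/-- The resolution supported on a labelled simplicial complex. -/
noncomputable def IsConical.resolution {e : V → s →₀ ℕ} {Δ : Finset (Finset V)}
    (h : IsConical e Δ) (hv : ∀ v, {v} ∈ Δ)
    (hmin : ∀ v, ∀ τ : Finset V, v ∉ τ → insert v τ ∈ Δ → ¬ e v ≤ label e τ) :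
    MinimalGradedFreeResolution (Ideal.span (Set.range fun v => monomial (e v) (1 : k))) where
  -- The ideal itself is resolved, not its quotient ring: vertices span degree `0`, and the empty
  -- face is the target of the augmentation.
  rank i := #(faces Δ (i + 1))
  shift i j := (label e (faceAt Δ (i + 1) j)).degree
  d i := restrictFaces s k Δ (i + 1) ∘ₗ differential e ∘ₗ extendZero s k Δ (i + 2)
  aug := LinearMap.proj ∅ ∘ₗ differential e ∘ₗ extendZero s k Δ 1
  range_aug := by
    have hlabel : ∀ v, label e (insert v ∅) - label e ∅ = e v := fun v => by
      rw [label_empty, tsub_zero, label, insert_empty_eq, sup_singleton]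
    refine le_antisymm ?_ (Ideal.span_le.mpr ?_)
    · rintro _ ⟨y, rfl⟩
      simp only [LinearMap.comp_apply, LinearMap.proj_apply, differential_apply, hlabel]
      refine Ideal.sum_mem _ fun v _ => Ideal.mul_mem_right _ _ ?_
      have : sign v (∅ : Finset V) = 1 := by simp [sign]
      rw [this, Int.cast_one]
      exact Ideal.subset_span ⟨v, rfl⟩
    · rintro _ ⟨v, rfl⟩
      obtain ⟨j, hj⟩ := exists_faceAt_eq (Δ := Δ) (n := 1) (σ := {v})
        (by simpa [faces] using hv v)
      refine ⟨Pi.single j 1, ?_⟩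
      simp only [LinearMap.comp_apply, LinearMap.proj_apply, extendZero_single, hj,
        differential_apply]
      rw [sum_eq_single_of_mem v (by simp)]
      · rw [hlabel, insert_empty_eq, Pi.single_eq_same, mul_one]
        simp [sign]
      · intro w _ hw
        rw [insert_empty_eq, Pi.single_apply, if_neg (by simpa using hw), mul_zero]
  exact_zero y := by
    rw [Set.mem_range]
    refine Iff.trans ?_ (h.differential_eq_zero_iff 0 y)
    refine ⟨fun hy => funext fun σ => ?_, fun hy => congrFun hy ∅⟩
    by_cases hσ : σ = ∅
    · rw [hσ]; exact hy
    · refine h.differential_eq_zero (n := 0) (extendZero_of_notMem Δ 1 y) σ fun h' => hσ ?_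
      simp only [faces, mem_filter] at h'
      exact card_eq_zero.mp h'.2
  exact_succ i y := by
    rw [Set.mem_range]
    refine Iff.trans ?_ (h.differential_eq_zero_iff (i + 1) y)
    refine ⟨fun hy => ?_, fun hy => ?_⟩
    · rw [← h.extendZero_restrictFaces_differential]
      exact (congrArg (extendZero s k Δ (i + 1)) hy).trans (map_zero _)
    · exact (congrArg (restrictFaces s k Δ (i + 1)) hy).trans (map_zero _)
  aug_homogeneous j := by
    simp only [LinearMap.comp_apply, LinearMap.proj_apply, extendZero_single]
    rcases differential_single (k := k) e (faceAt Δ 1 j) ∅ with h0 | ⟨v, -, -, hv⟩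
    · rw [h0]; exact isHomogeneous_zero _ _ _
    · rw [hv]
      exact isHomogeneous_monomial _ (by rw [label_empty, tsub_zero])
  d_homogeneous i j l := by
    simp only [LinearMap.comp_apply, extendZero_single, restrictFaces_apply]
    rcases differential_single (k := k) e (faceAt Δ (i + 2) j) (faceAt Δ (i + 1) l) with
      h0 | ⟨v, -, hσ, hv⟩
    · exact .inl h0
    · refine .inr ⟨_, ?_, hv ▸ isHomogeneous_monomial _ rfl⟩
      rw [hσ]
      exact degree_label_insert e v _
  minimal i y l := by
    simp only [LinearMap.comp_apply, restrictFaces_apply, differential_apply]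
    refine Ideal.sum_mem _ fun v hv => ?_
    rw [mem_compl] at hv
    by_cases hm : insert v (faceAt Δ (i + 1) l) ∈ faces Δ (i + 2)
    · refine Ideal.mul_mem_right _ _ (monomial_mem_irrelevantIdeal ?_ _)
      rw [Ne, tsub_eq_zero_iff_le]
      exact fun h' => hmin v _ hv (mem_filter.mp hm).1
        ((le_sup (mem_insert_self v _)).trans h')
    · rw [extendZero_of_notMem _ _ _ _ hm, mul_zero]
      exact Ideal.zero_mem _

/-- A positive exponent in an lcm is attained by one of the monomials; positivity excludes the empty
lcm. -/
theorem exists_mem_le_of_le_label (e : V → s →₀ ℕ) (τ : Finset V) (x : s) {n : ℕ} (hn : 0 < n)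
    (h : n ≤ label e τ x) : ∃ w ∈ τ, n ≤ e w x := by
  induction τ using Finset.induction_on with
  | empty =>
    rw [label_empty, Finsupp.zero_apply] at h
    omega
  | insert a τ _ ih =>
    rw [label, sup_insert, Finsupp.sup_apply, le_sup_iff] at h
    rcases h with h | h
    · exact ⟨a, mem_insert_self _ _, h⟩
    · obtain ⟨w, hw, hle⟩ := ih h
      exact ⟨w, mem_insert_of_mem hw, hle⟩

end Resolution

end SimplicialResolution

/-! ### Independence polynomials of paths and cycles, and the numbers `K`. -/

namespace IndependencePolynomial
open Finset Polynomial

section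

variable {α : Type*} [DecidableEq α]

/-- The generating polynomial of the subsets of `A` that contain no `i` together with `r i`. -/
noncomputable def indPoly (r : α → α) (A : Finset α) : ℕ[X] :=
  ∑ S ∈ A.powerset with ∀ i ∈ S, r i ∉ S, X ^ #S

/-- Split by whether `a` is chosen: choosing it excludes both its neighbours. -/
theorem indPoly_insert (r : α → α) {a : α} {A : Finset α} (ha : a ∉ A) (hr : r a ≠ a) :
    indPoly r (insert a A) = indPoly r A + X * indPoly r {x ∈ A | r x ≠ a ∧ r a ≠ x} := by
  simp only [indPoly, sum_filter]
  rw [sum_powerset_insert ha]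
  congr 1
  rw [mul_sum]
  symm
  refine (sum_congr rfl fun S hS => ?_).trans (sum_subset (powerset_mono.mpr (filter_subset _ _))
    fun S hS hS' => ?_)
  · have hS1 : ∀ x ∈ S, x ∈ A ∧ r x ≠ a ∧ r a ≠ x := fun x hx =>
      mem_filter.mp (mem_powerset.mp hS hx)
    have haS : a ∉ S := fun h => ha (hS1 a h).1
    rw [card_insert_of_notMem haS, pow_succ', mul_ite, mul_zero]
    refine if_congr ⟨fun h i hi => ?_, fun h i hi => ?_⟩ rfl rfl
    · rw [mem_insert, not_or]
      rcases mem_insert.mp hi with rfl | hi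
      · exact ⟨hr, fun h' => (hS1 _ h').2.2 rfl⟩
      · exact ⟨(hS1 i hi).2.1, h i hi⟩
    · exact fun h' => h i (mem_insert_of_mem hi) (mem_insert_of_mem h')
  · rw [if_neg]
    intro h
    refine hS' (mem_powerset.mpr fun x hx => mem_filter.mpr ⟨mem_powerset.mp hS hx, ?_, ?_⟩)
    · rintro rfl
      exact h x (mem_insert_of_mem hx) (mem_insert_self _ _)
    · rintro rfl
      exact h a (mem_insert_self _ _) (mem_insert_of_mem hx)

theorem indPoly_empty (r : α → α) : indPoly r ∅ = 1 := by
  simp [indPoly, filter_singleton]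

end

/-- The independence polynomial of the path with `a` vertices. -/
noncomputable def pathPoly : ℕ → ℕ[X]
  | 0 => 1
  | 1 => 1 + X
  | a + 2 => pathPoly (a + 1) + X * pathPoly a

theorem val_finRotate (n : ℕ) (i : Fin (n + 2)) :
    (finRotate (n + 2) i : ℕ) = if (i : ℕ) = n + 1 then 0 else (i : ℕ) + 1 := by
  rw [coe_finRotate]
  simp [Fin.ext_iff]

/-- Since `lo ≥ 1` excludes `0`, the rotation never wraps around inside the interval, and removing
its top vertex gives the path recurrence. -/
theorem indPoly_interval (n : ℕ) (lo : ℕ) (hlo : 1 ≤ lo) (a : ℕ) (h : lo + a ≤ n + 2) :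
    indPoly (finRotate (n + 2)) {i | lo ≤ (i : ℕ) ∧ (i : ℕ) < lo + a} = pathPoly a := by
  induction a using Nat.twoStepInduction with
  | zero =>
    rw [pathPoly, filter_false_of_mem, indPoly_empty]
    omega
  | one =>
    have h1 : ({i | lo ≤ (i : ℕ) ∧ (i : ℕ) < lo + 1} : Finset (Fin (n + 2))) =
        insert ⟨lo, by omega⟩ ∅ := by
      ext i; simp [Fin.ext_iff]; omega
    rw [h1, indPoly_insert _ (by simp), filter_empty, indPoly_empty, pathPoly, mul_one]
    rw [Ne, Fin.ext_iff, val_finRotate]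
    dsimp only
    split_ifs <;> first | contradiction | omega
  | more a ih1 ih2 =>
    have h1 : ({i | lo ≤ (i : ℕ) ∧ (i : ℕ) < lo + (a + 2)} : Finset (Fin (n + 2))) =
        insert ⟨lo + (a + 1), by omega⟩
          ({i | lo ≤ (i : ℕ) ∧ (i : ℕ) < lo + (a + 1)} : Finset (Fin (n + 2))) := by
      ext i; simp [Fin.ext_iff]; omega
    rw [h1, indPoly_insert _ (by simp), ih2 (by omega), pathPoly, ← ih1 (by omega), filter_filter]
    · congr 3
      ext i
      simp only [mem_filter, mem_univ, true_and, Ne, Fin.ext_iff, val_finRotate]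
      split_ifs <;> first | contradiction | omega
    · rw [Ne, Fin.ext_iff, val_finRotate]
      dsimp only
      split_ifs <;> first | omega | simp

/-- Removing vertex `0` leaves a path on `n + 1` vertices; choosing it leaves one on `n - 1`. For `n
= 0` truncation gives `P_0 = 1`, which is the right value for `P_{-1}`. -/
theorem indPoly_cycle (n : ℕ) :
    indPoly (finRotate (n + 2)) univ = pathPoly n + 2 * X * pathPoly (n - 1) := by
  have h1 : (univ : Finset (Fin (n + 2))) = insert 0
      ({i | 1 ≤ (i : ℕ) ∧ (i : ℕ) < 1 + (n + 1)} : Finset (Fin (n + 2))) := by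
    ext i
    simp only [mem_univ, mem_insert, mem_filter, true_and, Fin.ext_iff, Fin.val_zero,
      true_iff]
    omega
  have h2 : ({i | 1 ≤ (i : ℕ) ∧ (i : ℕ) < 1 + (n + 1)} : Finset (Fin (n + 2))).filter
      (fun i => finRotate (n + 2) i ≠ 0 ∧ finRotate (n + 2) 0 ≠ i) =
      ({i | 2 ≤ (i : ℕ) ∧ (i : ℕ) < 2 + (n - 1)} : Finset (Fin (n + 2))) := by
    ext i
    simp only [mem_filter, mem_univ, true_and, Ne, Fin.ext_iff, val_finRotate, Fin.val_zero]
    have := i.isLt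
    split_ifs <;> first | contradiction | (simp only [not_false_eq_true, true_and]; omega) | omega
  have h3 : pathPoly (n + 1) = pathPoly n + X * pathPoly (n - 1) := by
    cases n with
    | zero => simp [pathPoly]
    | succ n => rw [pathPoly, Nat.add_sub_cancel]
  rw [h1, indPoly_insert _ (by simp), h2, indPoly_interval n 1 le_rfl _ (by omega), h3]
  · by_cases hn : n = 0
    · subst hn
      rw [filter_false_of_mem (by omega), indPoly_empty]
      simp [pathPoly]; ring
    · rw [indPoly_interval n 2 (by omega) _ (by omega)]; ring
  · rw [Ne, Fin.ext_iff, val_finRotate]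
    simp

theorem coeff_zero_pathPoly (m a : ℕ) : ((1 + X) ^ m * pathPoly a : ℕ[X]).coeff 0 = 1 := by
  have h : (pathPoly a).coeff 0 = 1 := by
    induction a using Nat.twoStepInduction with
    | zero => simp [pathPoly]
    | one => simp [pathPoly]
    | more a _ ih => simp [pathPoly, ih]
  rw [mul_coeff_zero, h, coeff_one_add_X_pow]
  simp

theorem diamondKNat_zero_right (m a : ℕ) : diamondKNat m a 0 = m + a := diamondK_base_right m a

/-- The path recurrence is the recurrence for `K`; in column `b = 0` the shifted term is the
constant coefficient `1`, whence `m + a`. -/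
theorem coeff_succ_pathPoly (m a b : ℕ) :
    ((1 + X) ^ m * pathPoly a : ℕ[X]).coeff (b + 1) = diamondKNat m a b := by
  induction a using Nat.twoStepInduction generalizing b with
  | zero => cases b <;> simp [pathPoly, coeff_one_add_X_pow, diamondKNat]
  | one =>
    rw [pathPoly, mul_add, mul_one, coeff_add, coeff_mul_X, coeff_one_add_X_pow,
      coeff_one_add_X_pow]
    cases b with
    | zero => simp [diamondKNat]
    | succ b =>
      rw [diamondKNat, add_comm]
      rfl
  | more a ih1 ih2 =>
    have : ((1 + X) ^ m * pathPoly (a + 2) : ℕ[X]) =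
        (1 + X) ^ m * pathPoly (a + 1) + (1 + X) ^ m * pathPoly a * X := by
      rw [pathPoly]; ring
    rw [this, coeff_add, coeff_mul_X, ih2]
    cases b with
    | zero =>
      rw [coeff_zero_pathPoly]
      simp only [diamondKNat_zero_right]
      ring
    | succ b => rw [ih1, diamondKNat, add_comm]

theorem diamondK_sub_three (n b : ℕ) :
    diamondK (n + 2) ((n + 2 : ℕ) - 3 : ℤ) b = diamondKNat (n + 2) (n - 1) b := by
  cases n with
  | zero =>
    -- The convention for `K_{-1,b}` agrees with `K_{0,b}`, the value selected by truncated
    -- subtraction.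
    have : ((0 + 2 : ℕ) - 3 : ℤ) = Int.negSucc 0 := rfl
    rw [this]
    exact (diamondK_base_zero _ _).symm
  | succ n =>
    have : ((n + 1 + 2 : ℕ) - 3 : ℤ) = Int.ofNat n := by simp; ring
    rw [this, Nat.add_sub_cancel]
    rfl

theorem diamondK_sub_two (n b : ℕ) :
    diamondK (n + 2) ((n + 2 : ℕ) - 2 : ℤ) b = diamondKNat (n + 2) n b := by
  have : ((n + 2 : ℕ) - 2 : ℤ) = Int.ofNat n := by simp
  rw [this]
  rfl

end IndependencePolynomial

/-! ### The complex of the ideal: cones, minimality and face count. -/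

section Diamond
open Finset MvPolynomial SimplicialResolution

/-- The exponents of the generators of `diamondIdeal`. -/
noncomputable def diamondExponent (m : ℕ) : Fin m ⊕ Fin m → (Fin m × Fin 2) →₀ ℕ
  | .inl i => Finsupp.single (i, 0) 3 + Finsupp.single (i, 1) 1
  | .inr i => Finsupp.single (i, 0) 2 + Finsupp.single (finRotate m i, 0) 1 +
      Finsupp.single (finRotate m i, 1) 1

theorem diamondIdeal_eq_span (k : Type*) [Field k] (m : ℕ) :
    diamondIdeal k m =
      Ideal.span (Set.range fun v => monomial (diamondExponent m v) (1 : k)) := by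
  rw [diamondIdeal]
  congr 1
  rw [← Set.Sum.elim_range]
  congr 1
  funext v
  rcases v with i | i
  · simp [-finRotate_apply, diamondExponent, X, monomial_pow, monomial_mul]
  · simp [-finRotate_apply, diamondExponent, X, monomial_pow, monomial_mul]

/-- The sets of generators of `diamondIdeal` that contain no two cyclically adjacent generators
of the first kind. -/
def diamondComplex (m : ℕ) : Finset (Finset (Fin m ⊕ Fin m)) :=
  {σ | ∀ i, .inl i ∈ σ → .inl (finRotate m i) ∉ σ}

theorem mem_diamondComplex {m : ℕ} {σ : Finset (Fin m ⊕ Fin m)} :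
    σ ∈ diamondComplex m ↔ ∀ i, .inl i ∈ σ → .inl (finRotate m i) ∉ σ := by
  simp [diamondComplex]

theorem finRotate_ne_self {m : ℕ} (hm : 2 ≤ m) (i : Fin m) : finRotate m i ≠ i := by
  obtain ⟨n, rfl⟩ := Nat.exists_eq_add_of_le' hm
  rw [Ne, Fin.ext_iff, IndependencePolynomial.val_finRotate]
  split_ifs <;> omega

theorem singleton_mem_diamondComplex {m : ℕ} (hm : 2 ≤ m) (v : Fin m ⊕ Fin m) :
    {v} ∈ diamondComplex m := by
  rw [mem_diamondComplex]
  intro i hi hi'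
  rw [mem_singleton] at hi hi'
  exact finRotate_ne_self hm i (Sum.inl_injective (hi'.trans hi.symm))

/-- The first generator supplies `x_{i1}^2`, the second `x_{(i+1)1} x_{(i+1)2}`. This is why
adjacent pairs can be left out of the complex. -/
theorem diamondExponent_inr_le {m : ℕ} (hm : 2 ≤ m) {α : (Fin m × Fin 2) →₀ ℕ} {i : Fin m}
    (h1 : diamondExponent m (.inl i) ≤ α) (h2 : diamondExponent m (.inl (finRotate m i)) ≤ α) :
    diamondExponent m (.inr i) ≤ α := by
  have hne := finRotate_ne_self hm i
  have h3 := h1 (i, 0)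
  have h4 := h2 (finRotate m i, 0)
  have h5 := h2 (finRotate m i, 1)
  simp only [diamondExponent, Finsupp.add_apply, Finsupp.single_apply, Prod.mk.injEq] at h3 h4 h5
  simp [-finRotate_apply] at h3 h4 h5
  rintro ⟨x, y⟩
  simp only [diamondExponent, Finsupp.add_apply, Finsupp.single_apply, Prod.mk.injEq]
  by_cases hx : finRotate m i = x
  · subst hx
    fin_cases y
    · simp [-finRotate_apply, hne.symm]; omega
    · simp [-finRotate_apply]; omega
  · by_cases hx' : i = x
    · subst hx'
      fin_cases y
      · simp [-finRotate_apply, hne]; omega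
      · simp [-finRotate_apply, hne]
    · simp [-finRotate_apply, hx, hx']

/-- A generator of the second kind dividing `α` is an apex, as such vertices are unconstrained. If
none divides `α`, no adjacent pair of the first kind does either, and the subcomplex is a full
simplex. -/
theorem isConical_diamond {m : ℕ} (hm : 2 ≤ m) :
    IsConical (diamondExponent m) (diamondComplex m) where
  mem_of_subset σ hσ τ hτ := by
    rw [mem_diamondComplex] at hσ ⊢
    exact fun i hi hi' => hσ i (hτ hi) (hτ hi')
  exists_apex α v _ hv := by
    by_cases h : ∃ j, diamondExponent m (.inr j) ≤ α
    · obtain ⟨j, hj⟩ := h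
      refine ⟨.inr j, hj, fun σ hσ _ => ?_⟩
      rw [mem_diamondComplex] at hσ ⊢
      simpa using hσ
    · refine ⟨v, hv, fun σ _ hα => mem_diamondComplex.mpr fun i hi hi' => h ⟨i, ?_⟩⟩
      have hle : ∀ w ∈ insert v σ, diamondExponent m w ≤ α := by
        intro w hw
        rcases mem_insert.mp hw with rfl | hw
        · exact hv
        · exact (le_sup hw).trans hα
      exact diamondExponent_inr_le hm (hle _ hi) (hle _ hi')

theorem not_diamondExponent_le_label {m : ℕ} (hm : 2 ≤ m) (v : Fin m ⊕ Fin m)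
    (τ : Finset (Fin m ⊕ Fin m)) (hv : v ∉ τ) (hΔ : insert v τ ∈ diamondComplex m) :
    ¬ diamondExponent m v ≤ label (diamondExponent m) τ := by
  intro hle
  have hne := finRotate_ne_self hm
  rw [mem_diamondComplex] at hΔ
  rcases v with i | i
  -- Only `x_{i1}^3 x_{i2}` contains the cube of `x_{i1}`.
  · have h1 : 3 ≤ label (diamondExponent m) τ (i, 0) := by
      refine le_trans ?_ (hle (i, 0))
      simp [-finRotate_apply, diamondExponent]
    obtain ⟨w, hw, h2⟩ := exists_mem_le_of_le_label _ _ _ (by omega) h1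
    rcases w with j | j
    · by_cases hj : j = i
      · exact hv (hj ▸ hw)
      · simp [-finRotate_apply, diamondExponent, hj] at h2
    · by_cases hj : j = i
      · subst hj
        simp [-finRotate_apply, diamondExponent, hne] at h2
      · simp only [diamondExponent, Finsupp.add_apply, Finsupp.single_apply, Prod.mk.injEq, hj,
          false_and, if_false] at h2
        simp [-finRotate_apply] at h2
        split_ifs at h2 <;> omega
  -- If `inl i` is in `τ`, its successor is not, and nothing else in `τ` contains `x_{(i+1)2}`.
  -- Otherwise nothing in `τ` contains `x_{i1}^2`.
  · by_cases hi : .inl i ∈ τ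
    · have h0 := hΔ i (mem_insert_of_mem hi)
      have h1 : 1 ≤ label (diamondExponent m) τ (finRotate m i, 1) := by
        refine le_trans ?_ (hle (finRotate m i, 1))
        simp [-finRotate_apply, diamondExponent]
      obtain ⟨w, hw, h2⟩ := exists_mem_le_of_le_label _ _ _ (by omega) h1
      rcases w with j | j
      · by_cases hj : j = finRotate m i
        · exact h0 (hj ▸ mem_insert_of_mem hw)
        · simp [-finRotate_apply, diamondExponent, hj] at h2
      · by_cases hj : j = i
        · exact hv (hj ▸ hw)
        · simp [-finRotate_apply, diamondExponent, hj] at h2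
    · have h1 : 2 ≤ label (diamondExponent m) τ (i, 0) := by
        refine le_trans ?_ (hle (i, 0))
        simp [-finRotate_apply, diamondExponent]
      obtain ⟨w, hw, h2⟩ := exists_mem_le_of_le_label _ _ _ (by omega) h1
      rcases w with j | j
      · by_cases hj : j = i
        · exact hi (hj ▸ hw)
        · simp [-finRotate_apply, diamondExponent, hj] at h2
      · by_cases hj : j = i
        · exact hv (hj ▸ hw)
        · simp only [diamondExponent, Finsupp.add_apply, Finsupp.single_apply, Prod.mk.injEq, hj,
            false_and, if_false] at h2
          simp [-finRotate_apply] at h2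
          split_ifs at h2 <;> omega

open Polynomial in
theorem sum_diamondComplex (n : ℕ) :
    ∑ σ ∈ diamondComplex (n + 2), (Polynomial.X ^ #σ : ℕ[X]) =
      IndependencePolynomial.indPoly (finRotate (n + 2)) univ * (1 + Polynomial.X) ^ (n + 2) := by
  have h : ((1 + Polynomial.X) ^ (n + 2) : ℕ[X]) =
      ∑ T : Finset (Fin (n + 2)), Polynomial.X ^ #T := by
    have := Fintype.sum_pow_mul_eq_add_pow (Fin (n + 2)) (Polynomial.X : ℕ[X]) 1
    simp only [one_pow, mul_one, Fintype.card_fin] at this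
    rw [add_comm, this]
  rw [h, IndependencePolynomial.indPoly, sum_mul_sum, ← sum_product']
  refine (sum_nbij' (fun p => p.1.disjSum p.2) (fun σ => (σ.toLeft, σ.toRight)) ?_ ?_ ?_ ?_ ?_).symm
  · rintro ⟨S, T⟩ hp
    rw [mem_diamondComplex]
    simpa using hp
  · intro σ hσ
    rw [mem_diamondComplex] at hσ
    simpa using hσ
  · rintro ⟨S, T⟩ _
    simp
  · intro σ _
    exact toLeft_disjSum_toRight
  · rintro ⟨S, T⟩ _
    rw [card_disjSum, pow_add]

/-- The first term stays a coefficient because at `i = 0` it is the constant one, outside the range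
of `K`; it then gives `β_0 = 2 + (m + (m - 2))`. -/
theorem card_faces_diamondComplex (n i : ℕ) :
    #(faces (diamondComplex (n + 2)) (i + 1)) =
      2 * ((1 + Polynomial.X) ^ (n + 2) * IndependencePolynomial.pathPoly (n - 1)).coeff i +
        diamondKNat (n + 2) n i := by
  have h := congrArg (fun p => Polynomial.coeff p (i + 1)) (sum_diamondComplex n)
  simp only [Polynomial.finsetSum_coeff, Polynomial.coeff_X_pow, sum_boole] at h
  rw [IndependencePolynomial.indPoly_cycle] at h
  have h2 : ((IndependencePolynomial.pathPoly n +
      2 * Polynomial.X * IndependencePolynomial.pathPoly (n - 1)) * (1 + Polynomial.X) ^ (n + 2)) =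
      (1 + Polynomial.X) ^ (n + 2) * IndependencePolynomial.pathPoly n +
      Polynomial.C 2 * ((1 + Polynomial.X) ^ (n + 2) * IndependencePolynomial.pathPoly (n - 1)) *
        Polynomial.X := by
    simp only [map_ofNat]; ring
  rw [h2, Polynomial.coeff_add, IndependencePolynomial.coeff_succ_pathPoly,
    Polynomial.coeff_mul_X, Polynomial.coeff_C_mul] at h
  rw [Nat.add_comm (2 * _), ← h, faces]
  simp only [eq_comm, Nat.cast_id]

end Diamond

theorem mainTheorem5 (k : Type*) [Field k] (m : ℕ) (hm : 2 ≤ m) :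
    ∃ β : ℕ → ℕ, IsBettiSequence (diamondIdeal k m) β ∧
      β 0 = 2 * m ∧
      ∀ i : ℕ, 1 ≤ i →
        β i = 2 * diamondK m ((m : ℤ) - 3) (i - 1) + diamondK m ((m : ℤ) - 2) i := by
  obtain ⟨n, rfl⟩ := Nat.exists_eq_add_of_le' hm
  refine ⟨fun i => Finset.card (SimplicialResolution.faces (diamondComplex (n + 2)) (i + 1)),
    ?_, ?_, fun i hi => ?_⟩
  · rw [diamondIdeal_eq_span]
    exact ⟨⟨(isConical_diamond hm).resolution (singleton_mem_diamondComplex hm)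
      (not_diamondExponent_le_label hm)⟩, fun G i =>
      G.rank_eq_rank ((isConical_diamond hm).resolution (singleton_mem_diamondComplex hm)
        (not_diamondExponent_le_label hm)) i⟩
  · dsimp only
    rw [card_faces_diamondComplex, IndependencePolynomial.coeff_zero_pathPoly]
    rw [IndependencePolynomial.diamondKNat_zero_right]
    ring
  · obtain ⟨i, rfl⟩ := Nat.exists_eq_add_of_le' hi
    dsimp only
    rw [card_faces_diamondComplex, IndependencePolynomial.coeff_succ_pathPoly,
      IndependencePolynomial.diamondK_sub_three, IndependencePolynomial.diamondK_sub_two,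
      Nat.add_sub_cancel]
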